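/- All spaces are over $\mathbb{R}$. Let $\beta\mathbb{N}$ be the Stone–Čech compactification of the discrete space $\mathbb{N}$ and let $\beta\mathbb{N}^*=\beta\mathbb{N}\setminus\mathbb{N}$ with the subspace topology. For a compact Hausdorff space $K$ and a Banach space $X$, let $C(K,X)$ be the Banach space of continuous functions $K\to X$ with the supremum norm, and $C(K)=C(K,\mathbb{R})$. For a set $\Gamma$, let $c_0(\Gamma,X)$ be the Banach space, with the supremum norm, of all families $(x_\gamma)_{\gamma\in\Gamma}$ in $X$ such that $\{\gamma\in\Gamma:\|x_\gamma\|\ge\varepsilon\}$ is finite for every $\varepsilon>0$; let $\ell_\infty$ be the space of bounded real sequences with the supremum norm, $c_0=c_0(\mathbb{N},\mathbb{R})$, and let $\ell_\infty/c_0$ carry the quotient norm. Then there are linear isometric isomorphisms $$C(\beta\mathbb{N}^*\times\beta\mathbb{N})\;\cong\; C(\beta\mathbb{N}^*,\ell_\infty)\;\cong\; C(\beta\mathbb{N},\ell_\infty/c_0),$$ and, for every set $\Gamma$ of cardinality $\mathfrak{c}=2^{\aleph_0}$, each of these three spaces has a complemented subspace (the image of a bounded linear projection) that is linearly homeomorphic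 to $c_0(\Gamma,\ell_\infty/c_0)$. In short, $C(\beta\mathbb{N}^*\times\beta\mathbb{N})$ has a complemented subspace isomorphic to $c_0(\mathfrak{c},\ell_\infty/c_0)$. -/

import Mathlib

open Topology Filter
open scoped ENNReal

/-- The `ℓ_∞`-sum `ℓ_∞(Γ, X)`: all bounded families in `X` indexed by `Γ`, with the sup norm. -/
abbrev EllInf (Γ : Type*) (X : Type*) [NormedAddCommGroup X] : Type _ :=
  lp (fun _ : Γ => X) ∞

/-- The `c_0`-sum `c_0(Γ, X)`: the families `(x_γ)` in `X` such that `{γ : ‖x_γ‖ ≥ ε}` is finite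
for every `ε > 0`, as a subspace of `ℓ_∞(Γ, X)` (so with the sup norm). -/
def cZero (Γ : Type*) (X : Type*) [NormedAddCommGroup X] [NormedSpace ℝ X] :
    Submodule ℝ (EllInf Γ X) where
  carrier := {f | ∀ ε : ℝ, 0 < ε → {γ : Γ | ε ≤ ‖f γ‖}.Finite}
  zero_mem' := by
    intro ε hε
    have : {γ : Γ | ε ≤ ‖(0 : EllInf Γ X) γ‖} = ∅ := by
      ext γ
      simp [hε]
    rw [this]
    exact Set.finite_empty
  add_mem' := by
    intro f g hf hg ε hε
    refine ((hf (ε / 2) (half_pos hε)).union (hg (ε / 2) (half_pos hε))).subset ?_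
    intro γ hγ
    have h1 : ε ≤ ‖f γ + g γ‖ := hγ
    have h2 := norm_add_le (f γ) (g γ)
    by_contra hcon
    simp only [Set.mem_union, Set.mem_ofPred_eq, not_or, not_le] at hcon
    linarith [hcon.1, hcon.2]
  smul_mem' := by
    intro c f hf ε hε
    have hc : 0 < ‖c‖ + 1 := by positivity
    refine (hf (ε / (‖c‖ + 1)) (div_pos hε hc)).subset ?_
    intro γ hγ
    have h1 : ε ≤ ‖c • f γ‖ := hγ
    rw [norm_smul] at h1
    have h2 := norm_nonneg (f γ)
    show ε / (‖c‖ + 1) ≤ ‖f γ‖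
    rw [div_le_iff₀ hc]
    nlinarith

/-- `c_0(Γ, X)` is closed in `ℓ_∞(Γ, X)`, so the quotient carries the quotient norm. -/
instance cZero_isClosed (Γ : Type*) (X : Type*) [NormedAddCommGroup X] [NormedSpace ℝ X] :
    IsClosed (cZero Γ X : Set (EllInf Γ X)) := by
  refine isClosed_of_closure_subset ?_
  intro f hf ε hε
  obtain ⟨g, hg, hfg⟩ := Metric.mem_closure_iff.1 hf (ε / 2) (half_pos hε)
  refine (hg (ε / 2) (half_pos hε)).subset ?_
  intro γ hγ
  have h1 : ε ≤ ‖f γ‖ := hγ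
  have h2 : ‖(f - g) γ‖ ≤ ‖f - g‖ := lp.norm_apply_le_norm (by simp) (f - g) γ
  rw [dist_eq_norm] at hfg
  have h3 : ‖f γ‖ - ‖g γ‖ ≤ ‖(f - g) γ‖ := norm_sub_norm_le (f γ) (g γ)
  show ε / 2 ≤ ‖g γ‖
  linarith

/-- The quotient Banach space `ℓ_∞ / c_0`. -/
abbrev EllInfModCZero : Type := EllInf ℕ ℝ ⧸ cZero ℕ ℝ

/-- `βℕ`, the Stone–Čech compactification of the discrete space `ℕ`. -/
abbrev BetaN : Type := StoneCech ℕ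

/-- The Stone–Čech remainder `βℕ \ ℕ`, with the subspace topology. -/
abbrev BetaNStar : Type := {x : BetaN // x ∉ Set.range (stoneCechUnit : ℕ → BetaN)}

/-- `ℕ` is open in `βℕ`. -/
theorem isOpen_range_stoneCechUnit_nat :
    IsOpen (Set.range (stoneCechUnit : ℕ → BetaN)) := by
  rw [isOpen_iff_forall_mem_open]
  rintro _ ⟨n, rfl⟩
  have hd : Continuous (fun m : ℕ => decide (m = n)) := continuous_of_discreteTopology
  have he := continuous_stoneCechExtend hd
  have hU : IsOpen (stoneCechExtend hd ⁻¹' {true}) := (isOpen_discrete _).preimage he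
  refine ⟨stoneCechExtend hd ⁻¹' {true}, ?_, hU, ?_⟩
  · intro x hx
    by_contra hxr
    have hne : x ∈ ({stoneCechUnit n} : Set BetaN)ᶜ := fun h => hxr ⟨n, h.symm⟩
    obtain ⟨m, hm1, hm2⟩ := denseRange_stoneCechUnit.exists_mem_open
      (hU.inter isOpen_compl_singleton) ⟨x, hx, hne⟩
    rw [Set.mem_preimage, stoneCechExtend_stoneCechUnit, Set.mem_singleton_iff,
      decide_eq_true_eq] at hm1
    exact hm2 (by rw [hm1]; rfl)
  · simp [stoneCechExtend_stoneCechUnit]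

/-- The remainder `βℕ \ ℕ` is compact. -/
instance betaNStar_compactSpace : CompactSpace BetaNStar :=
  isCompact_iff_compactSpace.1 isOpen_range_stoneCechUnit_nat.isClosed_compl.isCompact

/-- `Y` has a complemented subspace isomorphic to `X`: some subspace of `Y` is the image of a
bounded linear projection on `Y` and is linearly homeomorphic to `X`. -/
def HasComplementedCopy (Y X : Type*) [NormedAddCommGroup Y] [NormedSpace ℝ Y]
    [NormedAddCommGroup X] [NormedSpace ℝ X] : Prop :=
  ∃ P : Y →L[ℝ] Y, (∀ y, P (P y) = P y) ∧ Nonempty (X ≃L[ℝ] LinearMap.range (P : Y →ₗ[ℝ] Y))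

/-! ### Complemented copies -/

/-! The isometries come from currying over either factor of the product, together with
`betaNIsometry` (`C(βℕ) = ℓ_∞`) and `remainderIsometry` (`ℓ_∞ / c_0 = C(βℕ \ ℕ)`).

For the complemented copy, put `K = βℕ \ ℕ`, `X = ℓ_∞`, `E = C(K)`; it suffices to find bounded `J :
c_0(Γ, E) → C(K, X)` and `R` back with `R ∘ J = id`. Two families indexed by the Cantor set are
combined. The branches of the binary tree are almost disjoint infinite subsets of `ℕ`, so they give
pairwise disjoint clopen sets in `K` with indicators `χ γ`, and maps `j γ : K → K` into these sets
with left inverses `ρ γ`. The Walsh functions give contractive functionals `φ γ` on `ℓ_∞` that are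
null at every vector, and unit-ball vectors `x γ` with `φ γ (x γ) = 1`.

Then `J g = ∑ χ γ • (g γ ∘ ρ γ) • x γ` and `R f = (φ γ ∘ f ∘ j γ)`. The image of `f` is compact, so
`φ γ` is null uniformly on it and `R f` lies in the `c_0`-sum (`finite_le_norm_comp`). Disjointness
of the `χ γ` gives `R (J g) = g` (`nullFamilyMap_disjointSum`). -/

theorem HasComplementedCopy.of_leftInverse {Y X : Type*} [NormedAddCommGroup Y] [NormedSpace ℝ Y]
    [NormedAddCommGroup X] [NormedSpace ℝ X] (J : X →L[ℝ] Y) (R : Y →L[ℝ] X)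
    (h : ∀ x, R (J x) = x) : HasComplementedCopy Y X := by
  refine ⟨J.comp R, fun y => by simp [h], ⟨?_⟩⟩
  have hm : ∀ x, J x ∈ LinearMap.range ((J.comp R : Y →L[ℝ] Y) : Y →ₗ[ℝ] Y) :=
    fun x => ⟨J x, by simp [h]⟩
  refine ContinuousLinearEquiv.equivOfInverse (J.codRestrict _ hm)
    (R.comp (Submodule.subtypeL _)) h ?_
  rintro ⟨_, y, rfl⟩
  exact Subtype.ext (congrArg J (h (R y)))

/-! ### Isometries between spaces of continuous functions -/

section Isometries

variable {K L E F : Type*} [TopologicalSpace K] [CompactSpace K] [TopologicalSpace L]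
  [CompactSpace L] [NormedAddCommGroup E] [NormedSpace ℝ E] [NormedAddCommGroup F]
  [NormedSpace ℝ F]

/-- Currying as a linear isometry `C(K × L, E) ≃ C(K, C(L, E))`. -/
noncomputable def curryIsometry [LocallyCompactSpace L] :
    C(K × L, E) ≃ₗᵢ[ℝ] C(K, C(L, E)) where
  toFun := ContinuousMap.curry
  invFun := ContinuousMap.uncurry
  map_add' _ _ := rfl
  map_smul' _ _ := rfl
  left_inv _ := by ext ⟨_, _⟩; rfl
  right_inv _ := rfl
  norm_map' f := by
    change ‖ContinuousMap.curry f‖ = ‖f‖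
    refine le_antisymm ?_ ?_
    · refine (ContinuousMap.norm_le _ (norm_nonneg _)).2 fun x => ?_
      exact (ContinuousMap.norm_le _ (norm_nonneg _)).2 fun y => f.norm_coe_le_norm (x, y)
    · refine (ContinuousMap.norm_le _ (norm_nonneg _)).2 fun p => ?_
      exact ((ContinuousMap.curry f p.1).norm_coe_le_norm p.2).trans
        ((ContinuousMap.curry f).norm_coe_le_norm p.1)

/-- Postcomposition with a linear isometric isomorphism. -/
noncomputable def postcompIsometry (e : E ≃ₗᵢ[ℝ] F) : C(K, E) ≃ₗᵢ[ℝ] C(K, F) where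
  toFun f := ⟨fun x => e (f x), e.continuous.comp f.continuous⟩
  invFun f := ⟨fun x => e.symm (f x), e.symm.continuous.comp f.continuous⟩
  map_add' _ _ := by ext; simp
  map_smul' _ _ := by ext; simp
  left_inv _ := by ext; simp
  right_inv _ := by ext; simp
  norm_map' f := by
    refine le_antisymm ?_ ?_
    · refine (ContinuousMap.norm_le _ (norm_nonneg _)).2 fun x => ?_
      simpa using f.norm_coe_le_norm x
    · refine (ContinuousMap.norm_le _ (norm_nonneg _)).2 fun x => ?_
      rw [← e.norm_map (f x)]
      exact ContinuousMap.norm_coe_le_norm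
        (⟨fun x => e (f x), e.continuous.comp f.continuous⟩ : C(K, F)) x

/-- Precomposition with a homeomorphism. -/
noncomputable def precompIsometry (h : L ≃ₜ K) : C(K, E) ≃ₗᵢ[ℝ] C(L, E) where
  toFun f := f.comp h
  invFun f := f.comp h.symm
  map_add' _ _ := rfl
  map_smul' _ _ := rfl
  left_inv _ := by ext; simp
  right_inv _ := by ext; simp
  norm_map' f := by
    refine le_antisymm ?_ ?_
    · exact (ContinuousMap.norm_le _ (norm_nonneg _)).2 fun x => f.norm_coe_le_norm (h x)
    · refine (ContinuousMap.norm_le _ (norm_nonneg _)).2 fun x => ?_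
      simpa using ContinuousMap.norm_coe_le_norm (f.comp (h : C(L, K))) (h.symm x)

end Isometries

/-! ### The spaces `C(βℕ)` and `C(βℕ \ ℕ)` -/

theorem EllInf.norm_apply_le {Γ X : Type*} [NormedAddCommGroup X] (f : EllInf Γ X) (γ : Γ) :
    ‖f γ‖ ≤ ‖f‖ :=
  lp.norm_apply_le_norm (by simp) f γ

theorem exists_betaN_extension (f : EllInf ℕ ℝ) :
    ∃ g : C(BetaN, ℝ), ∀ n, g (stoneCechUnit n) = f n := by
  have hf : ∀ n, f n ∈ Set.Icc (-‖f‖) ‖f‖ := fun n => abs_le.1 (EllInf.norm_apply_le f n)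
  have hc : Continuous fun n => (⟨f n, hf n⟩ : Set.Icc (-‖f‖) ‖f‖) :=
    continuous_of_discreteTopology
  refine ⟨⟨fun x => (stoneCechExtend hc x).1,
    continuous_subtype_val.comp (continuous_stoneCechExtend hc)⟩, fun n => ?_⟩
  simp [stoneCechExtend_stoneCechUnit]

/-- Restriction of functions on `βℕ` to `ℕ`, as an isometry `C(βℕ) ≃ ℓ_∞`. -/
noncomputable def betaNIsometry : C(BetaN, ℝ) ≃ₗᵢ[ℝ] EllInf ℕ ℝ :=
  LinearIsometryEquiv.ofSurjective
    { toFun := fun g => ⟨fun n => g (stoneCechUnit n), memℓp_infty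
        ⟨‖g‖, by rintro _ ⟨n, rfl⟩; exact g.norm_coe_le_norm _⟩⟩
      map_add' := fun _ _ => rfl
      map_smul' := fun _ _ => rfl
      norm_map' := fun g => by
        refine le_antisymm ?_ ?_
        · exact lp.norm_le_of_forall_le (norm_nonneg _) fun n => g.norm_coe_le_norm _
        · refine (ContinuousMap.norm_le _ (norm_nonneg _)).2 fun x => ?_
          refine denseRange_stoneCechUnit.induction_on x
            (isClosed_le (by fun_prop) continuous_const) fun n => ?_
          exact EllInf.norm_apply_le (⟨fun n => g (stoneCechUnit n), memℓp_infty
            ⟨‖g‖, by rintro _ ⟨n, rfl⟩; exact g.norm_coe_le_norm _⟩⟩ : EllInf ℕ ℝ) n }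
    (fun f => by
      obtain ⟨g, hg⟩ := exists_betaN_extension f
      exact ⟨g, by ext n; exact hg n⟩)

@[simp]
theorem betaNIsometry_apply (g : C(BetaN, ℝ)) (n : ℕ) :
    betaNIsometry g n = g (stoneCechUnit n) := rfl

/-- The trace on `ℕ` of the neighbourhood filter of a point of `βℕ`. -/
def BetaN.trace (x : BetaN) : Filter ℕ := comap stoneCechUnit (𝓝 x)

instance BetaN.trace_neBot (x : BetaN) : (BetaN.trace x).NeBot :=
  isDenseInducing_stoneCechUnit.comap_nhds_neBot x

theorem BetaN.tendsto_trace {Y : Type*} [TopologicalSpace Y] {f : BetaN → Y} (hf : Continuous f)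
    (x : BetaN) : Tendsto (fun n => f (stoneCechUnit n)) (BetaN.trace x) (𝓝 (f x)) :=
  (hf.tendsto x).comp tendsto_comap

theorem injective_stoneCechUnit_nat : Function.Injective (stoneCechUnit : ℕ → BetaN) :=
  isDenseEmbedding_stoneCechUnit.injective

theorem isOpen_singleton_stoneCechUnit (n : ℕ) : IsOpen ({stoneCechUnit n} : Set BetaN) := by
  have hd : Continuous (fun m : ℕ => decide (m = n)) := continuous_of_discreteTopology
  have hU : IsOpen (stoneCechExtend hd ⁻¹' {true}) :=
    (isOpen_discrete _).preimage (continuous_stoneCechExtend hd)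
  convert hU.inter isOpen_range_stoneCechUnit_nat using 1
  ext x
  constructor
  · rintro rfl
    exact ⟨by simp [stoneCechExtend_stoneCechUnit], n, rfl⟩
  · rintro ⟨hx, m, rfl⟩
    rw [Set.mem_preimage, stoneCechExtend_stoneCechUnit, Set.mem_singleton_iff,
      decide_eq_true_eq] at hx
    rw [hx]
    rfl

/-- Finite subsets of `ℕ` stay closed in `βℕ` and miss the point `x`. -/
theorem BetaNStar.trace_le_cofinite (x : BetaNStar) : BetaN.trace x.1 ≤ cofinite := by
  intro s hs
  have hs' : (sᶜ).Finite := hs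
  refine mem_comap.2 ⟨(stoneCechUnit '' sᶜ)ᶜ, ?_, ?_⟩
  · refine (hs'.image _).isClosed.isOpen_compl.mem_nhds ?_
    rintro ⟨n, -, hn⟩
    exact x.2 ⟨n, hn⟩
  · intro n hn
    by_contra h
    exact hn ⟨n, h, rfl⟩

theorem forall_betaNStar_eq_zero_iff (g : C(BetaN, ℝ)) :
    (∀ x : BetaNStar, g x = 0) ↔ betaNIsometry g ∈ cZero ℕ ℝ := by
  constructor
  · intro h ε hε
    -- This closed set lies inside `ℕ`, so it is a compact set covered by open singletons.
    have hcl : IsClosed {x : BetaN | ε ≤ ‖g x‖} := isClosed_le continuous_const (by fun_prop)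
    obtain ⟨t, ht⟩ := hcl.isCompact.elim_finite_subcover
      (fun n : ℕ => ({stoneCechUnit n} : Set BetaN)) isOpen_singleton_stoneCechUnit (by
        intro x hx
        by_contra hn
        have h0 := h ⟨x, fun ⟨n, hn'⟩ => hn (Set.mem_iUnion.2 ⟨n, hn'.symm⟩)⟩
        have hx' : ε ≤ ‖g x‖ := hx
        rw [h0, norm_zero] at hx'
        exact absurd hx' (not_le.2 hε))
    refine t.finite_toSet.subset fun n hn => ?_
    have hn' : stoneCechUnit n ∈ {x : BetaN | ε ≤ ‖g x‖} := hn
    obtain ⟨m, hm, hnm⟩ := Set.mem_iUnion₂.1 (ht hn')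
    rw [injective_stoneCechUnit_nat hnm]
    exact hm
  · intro h x
    refine tendsto_nhds_unique (BetaN.tendsto_trace g.continuous x.1) ?_
    refine Tendsto.mono_left ?_ x.trace_le_cofinite
    rw [Metric.tendsto_nhds]
    intro ε hε
    refine (h ε hε).subset fun n hn => ?_
    simpa using hn

/-- Restriction of functions from `βℕ` to `βℕ \ ℕ`, read on `ℓ_∞`. -/
noncomputable def remainderRestrict : EllInf ℕ ℝ →ₗ[ℝ] C(BetaNStar, ℝ) where
  toFun f := (betaNIsometry.symm f).comp ⟨Subtype.val, continuous_subtype_val⟩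
  map_add' _ _ := by ext; simp
  map_smul' _ _ := by ext; simp

theorem remainderRestrict_apply (f : EllInf ℕ ℝ) (x : BetaNStar) :
    remainderRestrict f x = betaNIsometry.symm f x := rfl

theorem norm_remainderRestrict_le (f : EllInf ℕ ℝ) : ‖remainderRestrict f‖ ≤ ‖f‖ := by
  refine (ContinuousMap.norm_le _ (norm_nonneg _)).2 fun x => ?_
  rw [← betaNIsometry.symm.norm_map f]
  exact (betaNIsometry.symm f).norm_coe_le_norm x.1

theorem remainderRestrict_eq_zero_iff (f : EllInf ℕ ℝ) :
    remainderRestrict f = 0 ↔ f ∈ cZero ℕ ℝ := by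
  have h := forall_betaNStar_eq_zero_iff (betaNIsometry.symm f)
  rw [betaNIsometry.apply_symm_apply] at h
  rw [← h, ContinuousMap.ext_iff]
  rfl

/-- Tietze extension from the closed remainder, without increase of norm; this is what makes the
quotient map isometric. -/
theorem exists_remainderRestrict_eq (g : C(BetaNStar, ℝ)) :
    ∃ f, remainderRestrict f = g ∧ ‖f‖ = ‖g‖ := by
  obtain ⟨G, hG, hGr⟩ := BoundedContinuousFunction.exists_norm_eq_domRestrict_eq_of_closed
    (s := (Set.range (stoneCechUnit : ℕ → BetaN))ᶜ)
    (BoundedContinuousFunction.mkOfCompact (α := BetaNStar) g)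
    isOpen_range_stoneCechUnit_nat.isClosed_compl
  refine ⟨betaNIsometry G.toContinuousMap, ?_, ?_⟩
  · ext x
    rw [remainderRestrict_apply, betaNIsometry.symm_apply_apply]
    exact DFunLike.congr_fun hGr x
  · rw [betaNIsometry.norm_map, ← BoundedContinuousFunction.norm_mkOfCompact]
    exact hG

/-- The isometry `ℓ_∞ / c_0 ≃ C(βℕ \ ℕ)`. -/
noncomputable def remainderIsometry : EllInfModCZero ≃ₗᵢ[ℝ] C(BetaNStar, ℝ) :=
  LinearIsometryEquiv.ofSurjective
    { (cZero ℕ ℝ).liftQ remainderRestrict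
        (fun f hf => (remainderRestrict_eq_zero_iff f).2 hf) with
      norm_map' := fun q => by
        induction q using Submodule.Quotient.induction_on with
        | H f =>
          change ‖remainderRestrict f‖ = _
          refine le_antisymm ?_ ?_
          -- Every representative of the class has the same restriction, so one of nearly minimal
          -- norm bounds it.
          · refine le_of_forall_pos_le_add fun ε hε => ?_
            obtain ⟨m, hm, hmlt⟩ := Submodule.Quotient.norm_mk_lt
              (Submodule.Quotient.mk f : EllInfModCZero) hε
            have h0 := (remainderRestrict_eq_zero_iff _).2 ((Submodule.Quotient.eq _).1 hm)
            rw [map_sub, sub_eq_zero] at h0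
            rw [← h0]
            exact (norm_remainderRestrict_le m).trans hmlt.le
          · obtain ⟨f', hf', hn⟩ := exists_remainderRestrict_eq (remainderRestrict f)
            have hq : (Submodule.Quotient.mk f : EllInfModCZero) = Submodule.Quotient.mk f' := by
              refine (Submodule.Quotient.eq _).2 ((remainderRestrict_eq_zero_iff _).1 ?_)
              rw [map_sub, hf', sub_self]
            rw [hq, ← hn]
            exact Submodule.Quotient.norm_mk_le (S := cZero ℕ ℝ) f' }
    (fun g => by
      obtain ⟨f, hf, -⟩ := exists_remainderRestrict_eq g
      exact ⟨Submodule.Quotient.mk f, hf⟩)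

/-! ### Complemented copies of `c_0`-sums in spaces of vector-valued functions -/

section DisjointSum

variable {Γ K X : Type*} [NormedAddCommGroup X] [NormedSpace ℝ X]

/-- At most one term is nonzero at each point, so the `finsum` never takes its junk value. -/
theorem finite_support_smul_of_disjoint {χ : Γ → K → ℝ}
    (hχ : ∀ γ δ, γ ≠ δ → ∀ t, χ γ t * χ δ t = 0) (v : Γ → X) (t : K) :
    (Function.support fun γ => χ γ t • v γ).Finite := by
  refine Set.Subsingleton.finite fun γ hγ δ hδ => ?_
  by_contra hne
  rcases mul_eq_zero.1 (hχ γ δ hne t) with h | h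
  · exact hγ (by simp [h])
  · exact hδ (by simp [h])

theorem finsum_smul_eq_of_disjoint {χ : Γ → K → ℝ}
    (hχ : ∀ γ δ, γ ≠ δ → ∀ t, χ γ t * χ δ t = 0) (v : Γ → X) {t : K} {γ : Γ} (hγ : χ γ t ≠ 0) :
    ∑ᶠ δ, χ δ t • v δ = χ γ t • v γ := by
  refine finsum_eq_single _ γ fun δ hδ => ?_
  rw [(mul_eq_zero.1 (hχ δ γ hδ t)).resolve_right hγ, zero_smul]

theorem norm_finsum_smul_le_of_disjoint {χ : Γ → K → ℝ}
    (hχ : ∀ γ δ, γ ≠ δ → ∀ t, χ γ t * χ δ t = 0) (hχ1 : ∀ γ t, |χ γ t| ≤ 1)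
    (v : Γ → X) {C : ℝ} (hC : 0 ≤ C) (hv : ∀ γ, ‖v γ‖ ≤ C) (t : K) :
    ‖∑ᶠ δ, χ δ t • v δ‖ ≤ C := by
  by_cases h : ∃ γ, χ γ t ≠ 0
  · obtain ⟨γ, hγ⟩ := h
    rw [finsum_smul_eq_of_disjoint hχ v hγ, norm_smul]
    calc ‖χ γ t‖ * ‖v γ‖ ≤ 1 * C :=
          mul_le_mul (hχ1 γ t) (hv γ) (norm_nonneg _) zero_le_one
      _ = C := one_mul C
  · push Not at h
    simp [h, hC]

variable [TopologicalSpace K] [CompactSpace K]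

/-- Dropping the terms with `‖v γ‖ < ε / 2` leaves a finite continuous sum; by disjointness the
dropped terms do not add up, so the uniform error stays at most `ε / 2`. -/
theorem continuous_finsum_smul_of_disjoint {χ : Γ → C(K, ℝ)}
    (hχ : ∀ γ δ, γ ≠ δ → ∀ t, χ γ t * χ δ t = 0) (hχ1 : ∀ γ t, |χ γ t| ≤ 1)
    (v : Γ → C(K, X)) (hv : ∀ ε : ℝ, 0 < ε → {γ | ε ≤ ‖v γ‖}.Finite) :
    Continuous fun t => ∑ᶠ γ, χ γ t • v γ t := by
  classical
  refine continuous_of_uniform_approx_of_continuous fun u hu => ?_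
  obtain ⟨ε, hε, hεu⟩ := Metric.mem_uniformity_dist.1 hu
  let w : Γ → C(K, X) := fun γ => if ε / 2 ≤ ‖v γ‖ then 0 else v γ
  let F := (hv (ε / 2) (half_pos hε)).toFinset
  refine ⟨fun t => ∑ γ ∈ F, χ γ t • v γ t, by fun_prop, fun t => hεu ?_⟩
  have hsplit : ∑ᶠ γ, χ γ t • v γ t = ∑ γ ∈ F, χ γ t • v γ t + ∑ᶠ γ, χ γ t • w γ t := by
    have hF : ∑ γ ∈ F, χ γ t • v γ t = ∑ᶠ γ, χ γ t • (v γ t - w γ t) := by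
      rw [finsum_eq_sum_of_support_subset (s := F)]
      · refine Finset.sum_congr rfl fun γ hγ => ?_
        have : ε / 2 ≤ ‖v γ‖ := by simpa [F] using hγ
        simp [w, this]
      · intro γ hγ
        by_contra hn
        have : ¬ ε / 2 ≤ ‖v γ‖ := by simpa [F] using hn
        exact hγ (by simp [w, this])
    rw [hF, ← finsum_add_distrib
      (finite_support_smul_of_disjoint (χ := fun γ => χ γ) hχ (fun γ => v γ t - w γ t) t)
      (finite_support_smul_of_disjoint (χ := fun γ => χ γ) hχ (fun γ => w γ t) t)]
    refine finsum_congr fun γ => ?_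
    rw [← smul_add, sub_add_cancel]
  rw [hsplit, dist_eq_norm, add_sub_cancel_left]
  refine (norm_finsum_smul_le_of_disjoint (χ := fun γ => χ γ) hχ hχ1 (fun γ => w γ t)
    (half_pos hε).le (fun γ => ?_) t).trans_lt (half_lt_self hε)
  by_cases h : ε / 2 ≤ ‖v γ‖
  · simp [w, h, (half_pos hε).le]
  · simpa [w, h] using ((v γ).norm_coe_le_norm t).trans (not_le.1 h).le

/-- A pointwise null bounded family of functionals is null uniformly on compact sets. -/
theorem finite_le_norm_comp {φ : Γ → X →L[ℝ] ℝ} (hφ : ∀ γ x, |φ γ x| ≤ ‖x‖)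
    (hφ0 : ∀ x, ∀ ε : ℝ, 0 < ε → {γ | ε ≤ |φ γ x|}.Finite) (f : C(K, X)) {ε : ℝ} (hε : 0 < ε) :
    {γ | ∃ t, ε ≤ |φ γ (f t)|}.Finite := by
  obtain ⟨T, -, hT, hcov⟩ := Metric.totallyBounded_iff.1
    (isCompact_range f.continuous).totallyBounded (ε / 2) (half_pos hε) |>.imp
      fun T h => (⟨trivial, h.1, h.2⟩ : True ∧ _ ∧ _)
  refine (hT.biUnion fun x _ => hφ0 x (ε / 2) (half_pos hε)).subset ?_
  rintro γ ⟨t, ht⟩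
  obtain ⟨x, hx, hxt⟩ := Set.mem_iUnion₂.1 (hcov ⟨t, rfl⟩)
  refine Set.mem_iUnion₂.2 ⟨x, hx, ?_⟩
  rw [Metric.mem_ball, dist_eq_norm] at hxt
  have h1 := hφ γ (f t - x)
  rw [map_sub] at h1
  have h2 := abs_sub_abs_le_abs_sub (φ γ (f t)) (φ γ x)
  change ε / 2 ≤ |φ γ x|
  linarith

variable {E : Type*} [NormedAddCommGroup E] [NormedSpace ℝ E] (e : E ≃ₗᵢ[ℝ] C(K, ℝ))

/-- The embedding `c_0(Γ, E) → C(K, X)` given by disjointly supported functions `χ γ`. -/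
noncomputable def disjointSum {χ : Γ → C(K, ℝ)} (ρ : Γ → C(K, K)) {x : Γ → X}
    (hχ : ∀ γ δ, γ ≠ δ → ∀ t, χ γ t * χ δ t = 0) (hχ1 : ∀ γ t, |χ γ t| ≤ 1)
    (hx : ∀ γ, ‖x γ‖ ≤ 1) : cZero Γ E →L[ℝ] C(K, X) :=
  have hle : ∀ (g : cZero Γ E) γ t, ‖e (g.1 γ) (ρ γ t) • x γ‖ ≤ ‖g.1 γ‖ := fun g γ t => by
    rw [norm_smul, ← e.norm_map (g.1 γ)]
    exact (mul_le_mul ((e (g.1 γ)).norm_coe_le_norm _) (hx γ) (norm_nonneg _)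
      (norm_nonneg _)).trans_eq (mul_one _)
  LinearMap.mkContinuous
    { toFun := fun g => ⟨fun t => ∑ᶠ γ, χ γ t • e (g.1 γ) (ρ γ t) • x γ,
        continuous_finsum_smul_of_disjoint hχ hχ1
          (fun γ => ⟨fun t => e (g.1 γ) (ρ γ t) • x γ, by fun_prop⟩) fun ε hε =>
            (g.2 ε hε).subset fun γ hγ => le_trans hγ
              ((ContinuousMap.norm_le _ (norm_nonneg _)).2 (hle g γ))⟩
      map_add' := fun g h => by
        ext t
        have hs := fun g : cZero Γ E => finite_support_smul_of_disjoint (χ := fun γ => χ γ) hχ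
          (fun γ => e (g.1 γ) (ρ γ t) • x γ) t
        refine Eq.trans ?_ (finsum_add_distrib (hs g) (hs h))
        refine finsum_congr fun γ => ?_
        rw [← smul_add, ← add_smul, ← ContinuousMap.add_apply, ← map_add]
        rfl
      map_smul' := fun c g => by
        ext t
        have hs := finite_support_smul_of_disjoint (χ := fun γ => χ γ) hχ
          (fun γ => e (g.1 γ) (ρ γ t) • x γ) t
        refine Eq.trans ?_ (smul_finsum' c hs).symm
        refine finsum_congr fun γ => ?_
        rw [smul_comm c, smul_smul c, ← smul_eq_mul, ← ContinuousMap.smul_apply, ← map_smul]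
        rfl }
    1 fun g => by
      rw [one_mul]
      refine (ContinuousMap.norm_le _ (norm_nonneg _)).2 fun t => ?_
      exact norm_finsum_smul_le_of_disjoint (χ := fun γ => χ γ) hχ hχ1 _ (norm_nonneg _)
        (fun γ => (hle g γ t).trans (EllInf.norm_apply_le g.1 γ)) t

theorem disjointSum_apply {χ : Γ → C(K, ℝ)} (ρ : Γ → C(K, K)) {x : Γ → X}
    (hχ : ∀ γ δ, γ ≠ δ → ∀ t, χ γ t * χ δ t = 0) (hχ1 : ∀ γ t, |χ γ t| ≤ 1)
    (hx : ∀ γ, ‖x γ‖ ≤ 1) (g : cZero Γ E) (t : K) :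
    disjointSum e ρ hχ hχ1 hx g t = ∑ᶠ γ, χ γ t • e (g.1 γ) (ρ γ t) • x γ := rfl

/-- The operator `C(K, X) → c_0(Γ, E)` sending `f` to the family `φ γ ∘ f ∘ j γ`. -/
noncomputable def nullFamilyMap {φ : Γ → X →L[ℝ] ℝ} (j : Γ → C(K, K))
    (hφ : ∀ γ x, |φ γ x| ≤ ‖x‖)
    (hφ0 : ∀ x, ∀ ε : ℝ, 0 < ε → {γ | ε ≤ |φ γ x|}.Finite) : C(K, X) →L[ℝ] cZero Γ E :=
  have hle : ∀ (f : C(K, X)) γ,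
      ‖e.symm ((φ γ : C(X, ℝ)).comp (f.comp (j γ)))‖ ≤ ‖f‖ := fun f γ => by
    rw [e.symm.norm_map]
    exact (ContinuousMap.norm_le _ (norm_nonneg _)).2 fun t =>
      (hφ γ _).trans (f.norm_coe_le_norm _)
  LinearMap.mkContinuous
    { toFun := fun f => ⟨⟨fun γ => e.symm ((φ γ : C(X, ℝ)).comp (f.comp (j γ))),
        memℓp_infty ⟨‖f‖, by rintro _ ⟨γ, rfl⟩; exact hle f γ⟩⟩, fun ε hε => by
          refine (finite_le_norm_comp hφ hφ0 f (half_pos hε)).subset fun γ hγ => ?_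
          by_contra hn
          have hn' : ∀ t, |φ γ (f t)| ≤ ε / 2 := fun t =>
            (not_le.1 fun h => hn ⟨t, h⟩).le
          have hγ' : ε ≤ ‖e.symm ((φ γ : C(X, ℝ)).comp (f.comp (j γ)))‖ := hγ
          rw [e.symm.norm_map] at hγ'
          have := hγ'.trans
            ((ContinuousMap.norm_le _ (half_pos hε).le).2 fun t => hn' (j γ t))
          linarith⟩
      map_add' := fun f g => by
        ext γ
        refine Eq.trans (congrArg e.symm ?_) (map_add e.symm _ _)
        ext t
        exact map_add (φ γ) _ _
      map_smul' := fun c f => by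
        ext γ
        refine Eq.trans (congrArg e.symm ?_) (map_smul e.symm c _)
        ext t
        exact map_smul (φ γ) c _ }
    1 fun f => (lp.norm_le_of_forall_le (norm_nonneg _) (hle f)).trans_eq (one_mul _).symm

/-- On the image of `j γ` only the `γ` term survives, so the values `φ γ (x δ)` for `δ ≠ γ` play no
role and no biorthogonality is needed. -/
theorem nullFamilyMap_disjointSum {φ : Γ → X →L[ℝ] ℝ} {j : Γ → C(K, K)}
    (hφ : ∀ γ x, |φ γ x| ≤ ‖x‖)
    (hφ0 : ∀ x, ∀ ε : ℝ, 0 < ε → {γ | ε ≤ |φ γ x|}.Finite)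
    {χ : Γ → C(K, ℝ)} {ρ : Γ → C(K, K)} {x : Γ → X}
    (hχ : ∀ γ δ, γ ≠ δ → ∀ t, χ γ t * χ δ t = 0) (hχ1 : ∀ γ t, |χ γ t| ≤ 1)
    (hx : ∀ γ, ‖x γ‖ ≤ 1) (hφx : ∀ γ, φ γ (x γ) = 1) (hχj : ∀ γ t, χ γ (j γ t) = 1)
    (hρj : ∀ γ t, ρ γ (j γ t) = t) (g : cZero Γ E) :
    nullFamilyMap e j hφ hφ0 (disjointSum e ρ hχ hχ1 hx g) = g := by
  ext γ
  refine e.symm_apply_eq.2 ?_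
  ext t
  change φ γ (disjointSum e ρ hχ hχ1 hx g (j γ t)) = e (g.1 γ) t
  rw [disjointSum_apply, finsum_smul_eq_of_disjoint (χ := fun γ => χ γ) hχ _
    (γ := γ) (by rw [hχj]; exact one_ne_zero), hχj, hρj, one_smul, map_smul, hφx, smul_eq_mul,
    mul_one]

end DisjointSum

/-! ### A null family of functionals on `ℓ_∞` indexed by the Cantor set -/

/-- The Walsh function of a point of the Cantor set. -/
def walsh (a : ℕ → Bool) (s : Finset ℕ) : ℝ := ∏ i ∈ s, if a i then 1 else -1

theorem walsh_mul_self (a : ℕ → Bool) (s : Finset ℕ) : walsh a s * walsh a s = 1 := by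
  rw [walsh, ← Finset.prod_mul_distrib]
  refine Finset.prod_eq_one fun i _ => ?_
  split_ifs <;> norm_num

theorem abs_walsh (a : ℕ → Bool) (s : Finset ℕ) : |walsh a s| = 1 := by
  rw [walsh, Finset.abs_prod]
  refine Finset.prod_eq_one fun i _ => ?_
  split_ifs <;> norm_num

/-- The sum over subsets factors as a product of terms `1 ± 1`, and the factor at `i` vanishes. -/
theorem sum_walsh_mul_walsh_eq_zero {a b : ℕ → Bool} {n i : ℕ} (hi : i < n) (hab : a i ≠ b i) :
    ∑ s ∈ (Finset.range n).powerset, walsh a s * walsh b s = 0 := by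
  have h : ∀ s, walsh a s * walsh b s =
      ∏ k ∈ s, (if a k then 1 else -1 : ℝ) * (if b k then 1 else -1) := fun s => by
    rw [walsh, walsh, Finset.prod_mul_distrib]
  simp_rw [h]
  rw [← Finset.prod_one_add]
  refine Finset.prod_eq_zero (Finset.mem_range.2 hi) ?_
  cases ha : a i <;> cases hb : b i <;> simp_all

/-- The average of a function over the subsets of `{0, …, n - 1}`. -/
noncomputable def powersetAvg (n : ℕ) (y : Finset ℕ → ℝ) : ℝ :=
  (∑ s ∈ (Finset.range n).powerset, y s) / 2 ^ n

theorem abs_powersetAvg_le {y : Finset ℕ → ℝ} {C : ℝ} (hy : ∀ s, |y s| ≤ C) (n : ℕ) :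
    |powersetAvg n y| ≤ C := by
  rw [powersetAvg, abs_div, abs_of_pos (by positivity : (0 : ℝ) < 2 ^ n),
    div_le_iff₀ (by positivity)]
  refine (Finset.abs_sum_le_sum_abs _ _).trans ?_
  refine (Finset.sum_le_card_nsmul _ _ C fun s _ => hy s).trans_eq ?_
  simp [mul_comm]

theorem powersetAvg_walsh_mul_self (a : ℕ → Bool) (n : ℕ) :
    powersetAvg n (fun s => walsh a s * walsh a s) = 1 := by
  simp [powersetAvg, walsh_mul_self]

theorem eventually_sum_walsh_mul_walsh (F : Finset (ℕ → Bool)) :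
    ∀ᶠ n in atTop, ∀ a ∈ F, ∀ b ∈ F, a ≠ b →
      ∑ s ∈ (Finset.range n).powerset, walsh a s * walsh b s = 0 := by
  rw [eventually_all_finset]
  intro a _
  rw [eventually_all_finset]
  intro b _
  by_cases hab : a = b
  · exact Eventually.of_forall fun _ h => absurd hab h
  · obtain ⟨i, hi⟩ := Function.ne_iff.1 hab
    filter_upwards [eventually_gt_atTop i] with n hn _
    exact sum_walsh_mul_walsh_eq_zero hn hi

/-- Bessel's inequality for a finite orthogonal family of functions of square mean `M`. -/
theorem sum_sq_le_of_orthogonal {ι α : Type*} (S : Finset α) (F : Finset ι) (w : ι → α → ℝ)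
    (y : α → ℝ) (c : ι → ℝ) {M : ℝ} (hw : ∀ a ∈ F, ∑ s ∈ S, w a s * w a s = M)
    (hort : ∀ a ∈ F, ∀ b ∈ F, a ≠ b → ∑ s ∈ S, w a s * w b s = 0)
    (hc : ∀ a ∈ F, ∑ s ∈ S, w a s * y s = M * c a) :
    M * ∑ a ∈ F, c a ^ 2 ≤ ∑ s ∈ S, y s ^ 2 := by
  have h1 : ∑ s ∈ S, y s * ∑ a ∈ F, c a * w a s = M * ∑ a ∈ F, c a ^ 2 := by
    simp_rw [Finset.mul_sum]
    rw [Finset.sum_comm]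
    refine Finset.sum_congr rfl fun a ha => ?_
    calc ∑ s ∈ S, y s * (c a * w a s) = c a * ∑ s ∈ S, w a s * y s := by
          rw [Finset.mul_sum]; exact Finset.sum_congr rfl fun s _ => by ring
      _ = M * c a ^ 2 := by rw [hc a ha]; ring
  have h2 : ∑ s ∈ S, (∑ a ∈ F, c a * w a s) ^ 2 = M * ∑ a ∈ F, c a ^ 2 := by
    simp_rw [sq, Finset.sum_mul_sum, Finset.mul_sum]
    rw [Finset.sum_comm]
    refine Finset.sum_congr rfl fun a ha => ?_
    rw [Finset.sum_comm, Finset.sum_eq_single a]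
    · calc ∑ s ∈ S, c a * w a s * (c a * w a s) = c a * c a * ∑ s ∈ S, w a s * w a s := by
            rw [Finset.mul_sum]; exact Finset.sum_congr rfl fun s _ => by ring
        _ = M * (c a * c a) := by rw [hw a ha]; ring
    · intro b hb hba
      calc ∑ s ∈ S, c a * w a s * (c b * w b s) = c a * c b * ∑ s ∈ S, w a s * w b s := by
            rw [Finset.mul_sum]; exact Finset.sum_congr rfl fun s _ => by ring
        _ = 0 := by rw [hort a ha b hb hba.symm, mul_zero]
    · exact fun h => absurd ha h
  have h3 : 0 ≤ ∑ s ∈ S, (y s - ∑ a ∈ F, c a * w a s) ^ 2 :=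
    Finset.sum_nonneg fun s _ => sq_nonneg _
  have h4 : ∑ s ∈ S, (y s - ∑ a ∈ F, c a * w a s) ^ 2 = ∑ s ∈ S, y s ^ 2
      - 2 * ∑ s ∈ S, y s * ∑ a ∈ F, c a * w a s + ∑ s ∈ S, (∑ a ∈ F, c a * w a s) ^ 2 := by
    rw [Finset.mul_sum, ← Finset.sum_sub_distrib, ← Finset.sum_add_distrib]
    exact Finset.sum_congr rfl fun s _ => by ring
  rw [h4, h1, h2] at h3
  linarith

/-- Once `n` separates the finitely many points of `F`, their Walsh functions are orthogonal and
Bessel's inequality applies. -/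
theorem eventually_sum_powersetAvg_sq_le (F : Finset (ℕ → Bool)) {y : Finset ℕ → ℝ} {C : ℝ}
    (hy : ∀ s, |y s| ≤ C) :
    ∀ᶠ n in atTop, ∑ a ∈ F, powersetAvg n (fun s => walsh a s * y s) ^ 2 ≤ C ^ 2 := by
  filter_upwards [eventually_sum_walsh_mul_walsh F] with n hn
  have hM : (0 : ℝ) < 2 ^ n := by positivity
  have h := sum_sq_le_of_orthogonal (Finset.range n).powerset F walsh y
    (fun a => powersetAvg n fun s => walsh a s * y s) (M := 2 ^ n)
    (fun a _ => by simp [walsh_mul_self]) hn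
    (fun a _ => by rw [powersetAvg, mul_div_cancel₀ _ hM.ne'])
  have h2 : ∑ s ∈ (Finset.range n).powerset, y s ^ 2 ≤ 2 ^ n * C ^ 2 := by
    refine (Finset.sum_le_card_nsmul _ _ (C ^ 2) fun s _ => ?_).trans_eq (by simp)
    exact sq_le_sq' (by linarith [(abs_le.1 (hy s)).1]) (abs_le.1 (hy s)).2
  exact le_of_mul_le_mul_left (h.trans h2) hM

theorem exists_tendsto_powersetAvg (a : ℕ → Bool) {y : Finset ℕ → ℝ} {C : ℝ}
    (hy : ∀ s, |y s| ≤ C) : ∃ l, Tendsto (fun n => powersetAvg n fun s => walsh a s * y s)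
      (hyperfilter ℕ : Filter ℕ) (𝓝 l) := by
  have hb : ∀ n, powersetAvg n (fun s => walsh a s * y s) ∈ Set.Icc (-C) C := fun n =>
    abs_le.1 (abs_powersetAvg_le (fun s => by rw [abs_mul, abs_walsh, one_mul]; exact hy s) n)
  obtain ⟨l, -, hl⟩ := isCompact_Icc.ultrafilter_le_nhds
    ((hyperfilter ℕ).map fun n => powersetAvg n fun s => walsh a s * y s)
    (le_principal_iff.2 (Filter.mem_map.2 (Eventually.of_forall hb)))
  exact ⟨l, hl⟩

/-- The limit of the averages of a bounded sequence against a Walsh function. -/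
noncomputable def walshCoeff (a : ℕ → Bool) (x : EllInf ℕ ℝ) : ℝ :=
  (exists_tendsto_powersetAvg a
    (y := fun s => x (Encodable.encode s)) fun _ => EllInf.norm_apply_le x _).choose

theorem tendsto_walshCoeff (a : ℕ → Bool) (x : EllInf ℕ ℝ) :
    Tendsto (fun n => powersetAvg n fun s => walsh a s * x (Encodable.encode s))
      (hyperfilter ℕ : Filter ℕ) (𝓝 (walshCoeff a x)) :=
  (exists_tendsto_powersetAvg a
    (y := fun s => x (Encodable.encode s)) fun _ => EllInf.norm_apply_le x _).choose_spec

theorem abs_walshCoeff_le (a : ℕ → Bool) (x : EllInf ℕ ℝ) : |walshCoeff a x| ≤ ‖x‖ :=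
  le_of_tendsto (tendsto_walshCoeff a x).abs (Eventually.of_forall fun n =>
    abs_powersetAvg_le (fun s => by
      rw [abs_mul, abs_walsh, one_mul]; exact EllInf.norm_apply_le x _) n)

theorem walshCoeff_sum_sq_le (F : Finset (ℕ → Bool)) (x : EllInf ℕ ℝ) :
    ∑ a ∈ F, walshCoeff a x ^ 2 ≤ ‖x‖ ^ 2 :=
  le_of_tendsto (tendsto_finsetSum F fun a _ => (tendsto_walshCoeff a x).pow 2)
    ((eventually_sum_powersetAvg_sq_le F fun _ => EllInf.norm_apply_le x _).filter_mono
      Nat.hyperfilter_le_atTop)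

/-- Bessel's inequality survives the ultrafilter limit, so the coefficients are square summable over
the whole Cantor set. -/
theorem finite_le_abs_walshCoeff (x : EllInf ℕ ℝ) {ε : ℝ} (hε : 0 < ε) :
    {a | ε ≤ |walshCoeff a x|}.Finite := by
  have hs : Summable fun a => walshCoeff a x ^ 2 :=
    summable_of_sum_le (fun _ => sq_nonneg _) fun F => walshCoeff_sum_sq_le F x
  have h := hs.tendsto_cofinite_zero.eventually_lt_const (pow_pos hε 2)
  refine Set.Finite.subset h fun a ha hlt => ?_
  have ha' : ε ≤ |walshCoeff a x| := ha
  have hlt' : walshCoeff a x ^ 2 < ε ^ 2 := hlt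
  rw [← sq_abs] at hlt'
  exact absurd (pow_le_pow_left₀ hε.le ha' 2) (not_le.2 hlt')

/-- `walshCoeff` as a bounded functional on `ℓ_∞`. -/
noncomputable def walshFunctional (a : ℕ → Bool) : EllInf ℕ ℝ →L[ℝ] ℝ :=
  LinearMap.mkContinuous
    { toFun := walshCoeff a
      map_add' := fun x y => by
        refine tendsto_nhds_unique (tendsto_walshCoeff a (x + y)) ?_
        refine ((tendsto_walshCoeff a x).add (tendsto_walshCoeff a y)).congr fun n => ?_
        simp only [powersetAvg, lp.coeFn_add, Pi.add_apply, mul_add, Finset.sum_add_distrib,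
          add_div]
      map_smul' := fun c x => by
        refine tendsto_nhds_unique (tendsto_walshCoeff a (c • x)) ?_
        refine ((tendsto_walshCoeff a x).const_mul c).congr fun n => ?_
        simp only [powersetAvg, lp.coeFn_smul, Pi.smul_apply, smul_eq_mul, mul_left_comm _ c,
          ← Finset.mul_sum, mul_div_assoc] }
    1 fun x => by rw [one_mul]; exact abs_walshCoeff_le a x

theorem exists_walshFunctional_eq_one (a : ℕ → Bool) :
    ∃ x : EllInf ℕ ℝ, ‖x‖ ≤ 1 ∧ walshFunctional a x = 1 := by
  -- The witness is the Walsh function itself, read through the encoding; off the range of `encode`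
  -- it still has modulus one.
  have hle : ∀ n, ‖walsh a (Function.invFun Encodable.encode n)‖ ≤ 1 := fun n =>
    (abs_walsh a _).le
  refine ⟨⟨fun n => walsh a (Function.invFun Encodable.encode n), memℓp_infty
    ⟨1, by rintro _ ⟨n, rfl⟩; exact hle n⟩⟩, lp.norm_le_of_forall_le zero_le_one hle, ?_⟩
  refine tendsto_nhds_unique (tendsto_walshCoeff a _) (tendsto_const_nhds.congr fun n => ?_)
  refine (powersetAvg_walsh_mul_self a n).symm.trans ?_
  simp [Function.leftInverse_invFun Encodable.encode_injective _]

/-! ### Maps of `βℕ \ ℕ` and almost disjoint families -/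

/-- The extension of a map `ℕ → ℕ` to `βℕ`. -/
noncomputable def betaNMap (σ : ℕ → ℕ) : BetaN → BetaN :=
  stoneCechExtend (g := fun n => (stoneCechUnit (σ n) : BetaN)) continuous_of_discreteTopology

theorem continuous_betaNMap (σ : ℕ → ℕ) : Continuous (betaNMap σ) :=
  continuous_stoneCechExtend _

@[simp]
theorem betaNMap_stoneCechUnit (σ : ℕ → ℕ) (n : ℕ) :
    betaNMap σ (stoneCechUnit n) = stoneCechUnit (σ n) :=
  stoneCechExtend_stoneCechUnit _ n

/-- If the image were the isolated point `m`, then `σ = m` would hold along the trace of `x`, which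
avoids the finite fibre over `m`. -/
theorem betaNMap_notMem_range {σ : ℕ → ℕ} (hσ : Tendsto σ cofinite cofinite) (x : BetaNStar) :
    betaNMap σ x ∉ Set.range (stoneCechUnit : ℕ → BetaN) := by
  rintro ⟨m, hm⟩
  have h1 : ∀ᶠ n in BetaN.trace x.1, betaNMap σ (stoneCechUnit n) ∈ ({stoneCechUnit m} : Set _) :=
    (BetaN.tendsto_trace (continuous_betaNMap σ) x.1)
      ((isOpen_singleton_stoneCechUnit m).mem_nhds hm.symm)
  have h2 : ∀ᶠ n in BetaN.trace x.1, σ n ≠ m :=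
    x.trace_le_cofinite (hσ (Set.finite_singleton m).compl_mem_cofinite)
  obtain ⟨n, hn1, hn2⟩ := (h1.and h2).exists
  rw [betaNMap_stoneCechUnit] at hn1
  exact hn2 (injective_stoneCechUnit_nat hn1)

/-- The action of a finite-to-one map `ℕ → ℕ` on `βℕ \ ℕ`. -/
noncomputable def betaNStarMap {σ : ℕ → ℕ} (hσ : Tendsto σ cofinite cofinite) :
    C(BetaNStar, BetaNStar) :=
  ⟨fun x => ⟨betaNMap σ x, betaNMap_notMem_range hσ x⟩,
    ((continuous_betaNMap σ).comp continuous_subtype_val).subtype_mk _⟩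

theorem betaNStarMap_leftInverse {σ τ : ℕ → ℕ} (hσ : Tendsto σ cofinite cofinite)
    (hτ : Tendsto τ cofinite cofinite) (h : ∀ n, σ (τ n) = n) (x : BetaNStar) :
    betaNStarMap hσ (betaNStarMap hτ x) = x := by
  refine Subtype.ext ?_
  have hext : betaNMap σ ∘ betaNMap τ = id :=
    stoneCech_hom_ext ((continuous_betaNMap σ).comp (continuous_betaNMap τ)) continuous_id
      (by ext n; simp [h])
  exact congrFun hext x.1

/-- The indicator function on `βℕ \ ℕ` of the clopen set given by a set of natural numbers. -/
noncomputable def betaNStarIndicator (p : ℕ → Bool) : C(BetaNStar, ℝ) :=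
  ⟨fun x => if stoneCechExtend (continuous_of_discreteTopology (f := p)) x.1 then 1 else 0,
    (continuous_of_discreteTopology (f := fun b : Bool => if b then (1 : ℝ) else 0)).comp
      ((continuous_stoneCechExtend _).comp continuous_subtype_val)⟩

theorem abs_betaNStarIndicator_le (p : ℕ → Bool) (x : BetaNStar) :
    |betaNStarIndicator p x| ≤ 1 := by
  change |ite _ _ _| ≤ (1 : ℝ)
  split_ifs <;> simp

theorem eventually_eq_stoneCechExtend (p : ℕ → Bool) (x : BetaNStar) :
    ∀ᶠ n in BetaN.trace x.1,
      p n = stoneCechExtend (continuous_of_discreteTopology (f := p)) x.1 := by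
  have h := BetaN.tendsto_trace
    (continuous_stoneCechExtend (continuous_of_discreteTopology (f := p))) x.1
  rw [nhds_discrete, tendsto_pure] at h
  simpa [stoneCechExtend_stoneCechUnit] using h

/-- The trace of `x` ignores finite sets, so it contains some `n` outside the overlap at which `p`
and `q` already take their limit values. -/
theorem betaNStarIndicator_mul_eq_zero {p q : ℕ → Bool}
    (h : {n | p n = true ∧ q n = true}.Finite) (x : BetaNStar) :
    betaNStarIndicator p x * betaNStarIndicator q x = 0 := by
  obtain ⟨n, ⟨hp, hq⟩, hn⟩ := ((eventually_eq_stoneCechExtend p x).and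
    (eventually_eq_stoneCechExtend q x)).and
      (x.trace_le_cofinite h.compl_mem_cofinite) |>.exists
  change ite _ _ _ * ite _ _ _ = (0 : ℝ)
  rw [← hp, ← hq]
  split_ifs with h1 h2
  · exact absurd ⟨h1, h2⟩ hn
  all_goals simp

theorem betaNStarIndicator_map_eq_one {p : ℕ → Bool} {τ : ℕ → ℕ}
    (hτ : Tendsto τ cofinite cofinite) (h : ∀ n, p (τ n) = true) (x : BetaNStar) :
    betaNStarIndicator p (betaNStarMap hτ x) = 1 := by
  have hext : stoneCechExtend (continuous_of_discreteTopology (f := p)) ∘ betaNMap τ =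
      fun _ => true :=
    stoneCech_hom_ext ((continuous_stoneCechExtend _).comp (continuous_betaNMap τ))
      continuous_const (by ext n; simp [h, stoneCechExtend_stoneCechUnit])
  exact if_pos (congrFun hext x.1)

/-- The code of the initial segment of length `n` of a point of the Cantor set. -/
def branchCode (a : ℕ → Bool) (n : ℕ) : ℕ := Encodable.encode ((List.range n).map a)

theorem branchCode_eq_iff {a b : ℕ → Bool} {m n : ℕ} :
    branchCode a m = branchCode b n ↔ m = n ∧ ∀ i < n, a i = b i := by
  rw [branchCode, branchCode, Encodable.encode_inj]
  constructor
  · intro h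
    have hmn : m = n := by simpa using congrArg List.length h
    subst hmn
    exact ⟨rfl, by simpa [List.map_inj_left] using h⟩
  · rintro ⟨rfl, h⟩
    exact List.map_congr_left fun i hi => h i (List.mem_range.1 hi)

theorem branchCode_injective (a : ℕ → Bool) : Function.Injective (branchCode a) :=
  fun _ _ h => (branchCode_eq_iff.1 h).1

/-- Two branches share only the initial segments up to their first disagreement. -/
theorem finite_branchCode_inter {a b : ℕ → Bool} (hab : a ≠ b) :
    (Set.range (branchCode a) ∩ Set.range (branchCode b)).Finite := by
  obtain ⟨i, hi⟩ := Function.ne_iff.1 hab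
  refine ((Set.finite_le_nat i).image (branchCode a)).subset ?_
  rintro _ ⟨⟨m, rfl⟩, n, h⟩
  obtain ⟨rfl, h⟩ := branchCode_eq_iff.1 h.symm
  exact ⟨m, not_lt.1 fun hlt => hi (h i hlt), rfl⟩

theorem exists_finite_to_one_leftInverse {τ : ℕ → ℕ} (hτ : Function.Injective τ) :
    ∃ σ : ℕ → ℕ, Tendsto σ cofinite cofinite ∧ ∀ n, σ (τ n) = n := by
  classical
  -- The identity off the range of `τ`, rather than a constant, keeps each fibre to at most two
  -- points.
  refine ⟨Function.extend τ id id, ?_, fun n => hτ.extend_apply _ _ n⟩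
  refine Tendsto.cofinite_of_finite_preimage_singleton fun m => ?_
  refine (Set.toFinite {τ m, m}).subset fun k hk => ?_
  have hk' : Function.extend τ id id k = m := hk
  by_cases h : ∃ n, τ n = k
  · obtain ⟨n, rfl⟩ := h
    rw [hτ.extend_apply] at hk'
    exact Or.inl (congrArg τ hk')
  · rw [Function.extend_apply' _ _ _ h] at hk'
    exact Or.inr hk'

/-! ### The main theorem -/

theorem exists_leftInverse_cZero_remainder {Γ : Type*} {a : Γ → ℕ → Bool}
    (ha : Function.Injective a) :
    ∃ (J : cZero Γ EllInfModCZero →L[ℝ] C(BetaNStar, EllInf ℕ ℝ))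
      (R : C(BetaNStar, EllInf ℕ ℝ) →L[ℝ] cZero Γ EllInfModCZero), ∀ g, R (J g) = g := by
  classical
  choose σ hσ hσl using fun γ => exists_finite_to_one_leftInverse (branchCode_injective (a γ))
  choose x hx hφx using fun γ => exists_walshFunctional_eq_one (a γ)
  have hτ : ∀ γ, Tendsto (branchCode (a γ)) cofinite cofinite := fun γ =>
    (branchCode_injective (a γ)).tendsto_cofinite
  exact ⟨_, _, nullFamilyMap_disjointSum remainderIsometry
    (φ := fun γ => walshFunctional (a γ)) (j := fun γ => betaNStarMap (hτ γ))
    (χ := fun γ => betaNStarIndicator fun n => decide (n ∈ Set.range (branchCode (a γ))))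
    (ρ := fun γ => betaNStarMap (hσ γ))
    (fun γ => abs_walshCoeff_le (a γ))
    (fun x ε hε => Set.Finite.preimage (f := a) ha.injOn (finite_le_abs_walshCoeff x hε))
    (fun γ δ hγδ => betaNStarIndicator_mul_eq_zero
      (by simpa [Set.inter_def] using finite_branchCode_inter (ha.ne hγδ)))
    (fun γ => abs_betaNStarIndicator_le _) hx hφx
    (fun γ => betaNStarIndicator_map_eq_one (hτ γ) (by simp))
    (fun γ => betaNStarMap_leftInverse (hσ γ) (hτ γ) (hσl γ))⟩

theorem corollary3p4 (Γ : Type*) (hΓ : Cardinal.mk Γ = Cardinal.continuum) :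
    Nonempty (C(BetaNStar × BetaN, ℝ) ≃ₗᵢ[ℝ] C(BetaNStar, EllInf ℕ ℝ)) ∧
    Nonempty (C(BetaNStar, EllInf ℕ ℝ) ≃ₗᵢ[ℝ] C(BetaN, EllInfModCZero)) ∧
    HasComplementedCopy C(BetaNStar × BetaN, ℝ) (cZero Γ EllInfModCZero) ∧
    HasComplementedCopy C(BetaNStar, EllInf ℕ ℝ) (cZero Γ EllInfModCZero) ∧
    HasComplementedCopy C(BetaN, EllInfModCZero) (cZero Γ EllInfModCZero) := by
  have e₁ : C(BetaNStar × BetaN, ℝ) ≃ₗᵢ[ℝ] C(BetaNStar, EllInf ℕ ℝ) :=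
    curryIsometry.trans (postcompIsometry betaNIsometry)
  have e₂ : C(BetaNStar, EllInf ℕ ℝ) ≃ₗᵢ[ℝ] C(BetaN, EllInfModCZero) :=
    -- Swap the factors, then curry over `βℕ` instead of the remainder.
    e₁.symm.trans ((precompIsometry (Homeomorph.prodComm BetaN BetaNStar)).trans
      (curryIsometry.trans (postcompIsometry remainderIsometry.symm)))
  obtain ⟨a⟩ : Nonempty (Γ ↪ (ℕ → Bool)) := by
    refine Cardinal.lift_mk_le'.1 ?_
    rw [hΓ]
    simp
  obtain ⟨J, R, h⟩ := exists_leftInverse_cZero_remainder a.injective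
  refine ⟨⟨e₁⟩, ⟨e₂⟩, ?_, .of_leftInverse J R h, ?_⟩
  · exact .of_leftInverse
      ((e₁.symm.toContinuousLinearEquiv : _ →L[ℝ] C(BetaNStar × BetaN, ℝ)).comp J)
      (R.comp (e₁.toContinuousLinearEquiv : C(BetaNStar × BetaN, ℝ) →L[ℝ] _))
      fun g => (congrArg R (e₁.apply_symm_apply (J g))).trans (h g)
  · exact .of_leftInverse
      ((e₂.toContinuousLinearEquiv : _ →L[ℝ] C(BetaN, EllInfModCZero)).comp J)
      (R.comp (e₂.symm.toContinuousLinearEquiv : C(BetaN, EllInfModCZero) →L[ℝ] _))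
      fun g => (congrArg R (e₂.symm_apply_apply (J g))).trans (h g)
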